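/- Let $k$ be an algebraically closed field and $n\ge 1$. Consider finite-dimensional representations $M=(M_1,M_2,(M(\gamma_i))_{1\le i\le n})$ of the $n$-Kronecker quiver over $k$, i.e. finite-dimensional $k$-vector spaces $M_1,M_2$ with $k$-linear maps $M(\gamma_i):M_1\to M_2$ (equivalently, finite-dimensional modules over its path algebra), and write $\underline{\dim}\,M=(\dim_k M_1,\dim_k M_2)$. Let $\sigma,\sigma^{-}$ be the Bernstein--Gelfand--Ponomarev reflection functors: $\sigma M$ has $(\sigma M)_1=\ker\big(M_1^n\to M_2,\ (m_i)\mapsto\sum_i M(\gamma_i)m_i\big)$, $(\sigma M)_2=M_1$, with $\gamma_i$ acting as the $i$-th projection; $\sigma^{-}M$ has $(\sigma^{-}M)_1=M_2$, $(\sigma^{-}M)_2=\operatorname{coker}\big(M_1\to M_2^n,\ m\mapsto (M(\gamma_i)m)_i\big)$, with $\gamma_i$ induced by the $i$-th injection. An indecomposable representation $A$ is preprojective if $\sigma^tA=0$ for some $t\ge 0$, and preinjective if $(\sigma^{-})^tA=0$ for some $t\ge0$. A representation is regular if it has no indecomposable direct summand that is preprojective or preinjective. A nonzero regular representation $M$ is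 elementary if there is no short exact sequence $0\to L\to M\to N\to 0$ with $L,N$ nonzero and regular. Let $\mathbf F=\{(x,y)\mid \tfrac2n x\le y\le x\}$, and let $M$ be a nonzero representation with $\underline{\dim}\,M=(x,y)\in\mathbf F$ and $x\le n-1$. Then $M$ is elementary if and only if for every $0\ne m\in M_1$ the subrepresentation of $M$ generated by $m$ has dimension vector $(1,y)$. -/

import Mathlib

universe u v

/-- A finite-dimensional representation of the `n`-Kronecker quiver `1 ⇉ 2` (with arrows
`γ_i`, `i : Fin n`, all from vertex `1` to vertex `2`) over the field `k`. -/
structure KroneckerRep (k : Type u) [Field k] (n : ℕ) where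
  /-- The space at the source. -/
  V₁ : Type v
  /-- The space at the sink. -/
  V₂ : Type v
  [addCommGroup₁ : AddCommGroup V₁]
  [addCommGroup₂ : AddCommGroup V₂]
  [module₁ : Module k V₁]
  [module₂ : Module k V₂]
  [finite₁ : Module.Finite k V₁]
  [finite₂ : Module.Finite k V₂]
  /-- The structure maps `M(γ_i)`. -/
  γ : Fin n → V₁ →ₗ[k] V₂

namespace KroneckerRep

attribute [instance] addCommGroup₁ addCommGroup₂ module₁ module₂ finite₁ finite₂

variable {k : Type u} [Field k] {n : ℕ}

/-- The dimension vector `(dim M₁, dim M₂)`. -/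
noncomputable def dimVec (M : KroneckerRep.{u, v} k n) : ℕ × ℕ :=
  (Module.finrank k M.V₁, Module.finrank k M.V₂)

/-- `M = (0)`. -/
def IsZero (M : KroneckerRep.{u, v} k n) : Prop :=
  Subsingleton M.V₁ ∧ Subsingleton M.V₂

/-- Morphisms of representations. -/
structure Hom (M N : KroneckerRep.{u, v} k n) where
  f₁ : M.V₁ →ₗ[k] N.V₁
  f₂ : M.V₂ →ₗ[k] N.V₂
  comm : ∀ (i : Fin n) (m : M.V₁), f₂ (M.γ i m) = N.γ i (f₁ m)

/-- `M` and `N` are isomorphic representations. -/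
def Isomorphic (M N : KroneckerRep.{u, v} k n) : Prop :=
  ∃ f : Hom M N, Function.Bijective f.f₁ ∧ Function.Bijective f.f₂

/-- `(0) → L → M → N → (0)` is exact, where the two middle maps are `f` and `g`. -/
def IsShortExact {L M N : KroneckerRep.{u, v} k n} (f : Hom L M) (g : Hom M N) : Prop :=
  (Function.Injective f.f₁ ∧ Function.Injective f.f₂) ∧
  (Function.Exact f.f₁ g.f₁ ∧ Function.Exact f.f₂ g.f₂) ∧
  (Function.Surjective g.f₁ ∧ Function.Surjective g.f₂)

/-- The direct sum `M ⊕ N`. -/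
def directSum (M N : KroneckerRep.{u, v} k n) : KroneckerRep.{u, v} k n where
  V₁ := M.V₁ × N.V₁
  V₂ := M.V₂ × N.V₂
  γ i := (M.γ i).prodMap (N.γ i)

/-- `A` is (isomorphic to) a direct summand of `M`. -/
def IsDirectSummand (A M : KroneckerRep.{u, v} k n) : Prop :=
  ∃ B : KroneckerRep.{u, v} k n, Isomorphic M (directSum A B)

/-- `M` is nonzero and not a direct sum of two nonzero representations. -/
def Indecomposable (M : KroneckerRep.{u, v} k n) : Prop :=
  ¬ M.IsZero ∧
    ∀ A B : KroneckerRep.{u, v} k n, Isomorphic M (directSum A B) → A.IsZero ∨ B.IsZero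

/-- The map `M₁ⁿ → M₂`, `(m_i)_i ↦ ∑ i, γ_i m_i`. -/
def sumMap (M : KroneckerRep.{u, v} k n) : (Fin n → M.V₁) →ₗ[k] M.V₂ :=
  ∑ i, (M.γ i) ∘ₗ LinearMap.proj i

/-- The map `M₁ → M₂ⁿ`, `m ↦ (γ_i m)_i`. -/
def diagMap (M : KroneckerRep.{u, v} k n) : M.V₁ →ₗ[k] (Fin n → M.V₂) :=
  LinearMap.pi M.γ

/-- The Bernstein–Gelfand–Ponomarev reflection `σ` at the sink, on objects (the opposite quiver
being identified with the Kronecker quiver again): `(σM)₁ = ker (M₁ⁿ → M₂)`, `(σM)₂ = M₁`, and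
the arrows act by the coordinate projections. -/
def sigma (M : KroneckerRep.{u, v} k n) : KroneckerRep.{u, v} k n where
  V₁ := LinearMap.ker M.sumMap
  V₂ := M.V₁
  γ i := LinearMap.proj i ∘ₗ (LinearMap.ker M.sumMap).subtype

/-- The Bernstein–Gelfand–Ponomarev reflection `σ⁻` at the source, on objects:
`(σ⁻M)₁ = M₂`, `(σ⁻M)₂ = coker (M₁ → M₂ⁿ)`, and the arrows act by the coordinate
injections. -/
def sigmaInv (M : KroneckerRep.{u, v} k n) : KroneckerRep.{u, v} k n where
  V₁ := M.V₂
  V₂ := (Fin n → M.V₂) ⧸ LinearMap.range M.diagMap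
  γ i := (LinearMap.range M.diagMap).mkQ ∘ₗ LinearMap.single k (fun _ : Fin n => M.V₂) i

/-- An indecomposable `M` is preprojective if `σ^t M = (0)` for some `t ≥ 0`. -/
def IsPreprojective (M : KroneckerRep.{u, v} k n) : Prop :=
  M.Indecomposable ∧ ∃ t : ℕ, (sigma^[t] M).IsZero

/-- An indecomposable `M` is preinjective if `σ^{-t} M = (0)` for some `t ≥ 0`. -/
def IsPreinjective (M : KroneckerRep.{u, v} k n) : Prop :=
  M.Indecomposable ∧ ∃ t : ℕ, (sigmaInv^[t] M).IsZero

/-- `M` is regular if it has no indecomposable direct summand that is preprojective or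
preinjective. -/
def IsRegular (M : KroneckerRep.{u, v} k n) : Prop :=
  ∀ A : KroneckerRep.{u, v} k n, IsDirectSummand A M → ¬ A.IsPreprojective ∧ ¬ A.IsPreinjective

/-- `M` is elementary if it is nonzero, regular, and not the middle term of a short exact sequence
with nonzero regular end terms. -/
def IsElementary (M : KroneckerRep.{u, v} k n) : Prop :=
  ¬ M.IsZero ∧ M.IsRegular ∧
    ¬ ∃ (L N : KroneckerRep.{u, v} k n) (f : Hom L M) (g : Hom M N),
        IsShortExact f g ∧ ¬ L.IsZero ∧ L.IsRegular ∧ ¬ N.IsZero ∧ N.IsRegular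

/-- Subrepresentations (submodules) of `M`. -/
structure Subrep (M : KroneckerRep.{u, v} k n) where
  W₁ : Submodule k M.V₁
  W₂ : Submodule k M.V₂
  map_mem : ∀ (i : Fin n) (m : M.V₁), m ∈ W₁ → M.γ i m ∈ W₂

/-- A subrepresentation as a representation. -/
def Subrep.toRep {M : KroneckerRep.{u, v} k n} (U : M.Subrep) : KroneckerRep.{u, v} k n where
  V₁ := U.W₁
  V₂ := U.W₂
  γ i := (M.γ i).restrict (U.map_mem i)

/-- The submodule generated by an element `m ∈ M₁`: it is `k m` at the source and the span of the
`γ_i m` at the sink. -/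
def generated (M : KroneckerRep.{u, v} k n) (m : M.V₁) : M.Subrep where
  W₁ := Submodule.span k {m}
  W₂ := Submodule.span k (Set.range fun i => M.γ i m)
  map_mem i w hw := by
    obtain ⟨a, rfl⟩ := Submodule.mem_span_singleton.mp hw
    rw [map_smul]
    exact Submodule.smul_mem _ a (Submodule.subset_span ⟨i, rfl⟩)

/-- `M.generated m` contains `m` and is contained in every subrepresentation containing `m`. -/
theorem generated_least (M : KroneckerRep.{u, v} k n) (m : M.V₁) :
    m ∈ (M.generated m).W₁ ∧
      ∀ U : M.Subrep, m ∈ U.W₁ → (M.generated m).W₁ ≤ U.W₁ ∧ (M.generated m).W₂ ≤ U.W₂ := by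
  refine ⟨Submodule.mem_span_singleton_self m, fun U hm => ⟨?_, ?_⟩⟩
  · exact (Submodule.span_singleton_le_iff_mem m U.W₁).mpr hm
  · refine Submodule.span_le.mpr ?_
    rintro _ ⟨i, rfl⟩
    exact U.map_mem i m hm

/-- The set `F = {(x, y) | (2/n) x ≤ y ≤ x}`. -/
def F (n : ℕ) : Set (ℕ × ℕ) :=
  {p | (2 / n : ℚ) * p.1 ≤ p.2 ∧ p.2 ≤ p.1}

end KroneckerRep

namespace KroneckerRep

open Module

variable {k : Type u} [Field k] {n : ℕ}

/-! When both dimensions are below `n`, regularity only means having no simple direct summand, i.e.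
`Cofaithful` (no summand of dimension `(1, 0)`) and `SinkGenerated` (none of dimension `(0, 1)`).
Any other nonzero summand has both dimensions between `1` and `n - 1`, and no iterated reflection
kills it. The hypotheses give `0 < y ≤ x < n`, so this criterion applies to `M`, its
subrepresentations and its quotients. If some `m ≠ 0` generates a proper `S` in `M₂`, the largest
subrepresentation over `S` and its quotient are both regular, so `M` is not elementary. If every `m
≠ 0` generates `M₂`, a nonzero regular subrepresentation contains `M₂`, and a regular quotient by it
vanishes. -/

/-- No nonzero element of `M₁` is annihilated by all arrows. -/
def Cofaithful (M : KroneckerRep.{u, v} k n) : Prop :=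
  ∀ m : M.V₁, (∀ i, M.γ i m = 0) → m = 0

/-- `M₂` is spanned by the images of the arrows. -/
def SinkGenerated (M : KroneckerRep.{u, v} k n) : Prop :=
  ∀ W : Submodule k M.V₂, (∀ i m, M.γ i m ∈ W) → W = ⊤

/-! ### Growth of dimensions under reflection -/

theorem finrank_sigma_fst_add_le (M : KroneckerRep.{u, v} k n) :
    n * finrank k M.V₁ ≤ finrank k M.sigma.V₁ + finrank k M.V₂ := by
  have h := M.sumMap.finrank_range_add_finrank_ker
  have h' := Submodule.finrank_le (LinearMap.range M.sumMap)
  rw [finrank_pi_fintype] at h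
  simp only [Finset.sum_const, Finset.card_univ, Fintype.card_fin, smul_eq_mul] at h
  change _ ≤ finrank k (LinearMap.ker M.sumMap) + _
  omega

theorem finrank_sigmaInv_snd_add_le (M : KroneckerRep.{u, v} k n) :
    n * finrank k M.V₂ ≤ finrank k M.sigmaInv.V₂ + finrank k M.V₁ := by
  have h := (LinearMap.range M.diagMap).finrank_quotient_add_finrank
  have h' := M.diagMap.finrank_range_le
  rw [finrank_pi_fintype] at h
  simp only [Finset.sum_const, Finset.card_univ, Fintype.card_fin, smul_eq_mul] at h
  change _ ≤ finrank k ((Fin n → M.V₂) ⧸ LinearMap.range M.diagMap) + _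
  omega

theorem not_isZero_sigma_iterate (hn : 2 ≤ n) (t : ℕ) (M : KroneckerRep.{u, v} k n)
    (h₁ : 0 < finrank k M.V₁) (h₂ : finrank k M.V₂ ≤ (n - 1) * finrank k M.V₁) :
    ¬ (sigma^[t] M).IsZero := by
  induction t generalizing M with
  | zero =>
    rintro ⟨h, -⟩
    exact h₁.ne' (finrank_zero_iff.2 h)
  | succ t ih =>
    rw [Function.iterate_succ_apply]
    have h := M.finrank_sigma_fst_add_le
    obtain ⟨p, rfl⟩ : ∃ p, n = p + 2 := ⟨n - 2, by omega⟩
    -- `(σM)₂ = M₁`, so this monotonicity restores both hypotheses for `σM`.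
    have h₃ : finrank k M.V₁ ≤ finrank k M.sigma.V₁ := by
      rw [show p + 2 - 1 = p + 1 from rfl] at h₂
      linarith
    refine ih _ (h₁.trans_le h₃) (h₃.trans ?_)
    exact Nat.le_mul_of_pos_left _ (by omega)

theorem not_isZero_sigmaInv_iterate (hn : 2 ≤ n) (t : ℕ) (M : KroneckerRep.{u, v} k n)
    (h₁ : 0 < finrank k M.V₂) (h₂ : finrank k M.V₁ ≤ (n - 1) * finrank k M.V₂) :
    ¬ (sigmaInv^[t] M).IsZero := by
  induction t generalizing M with
  | zero =>
    rintro ⟨-, h⟩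
    exact h₁.ne' (finrank_zero_iff.2 h)
  | succ t ih =>
    rw [Function.iterate_succ_apply]
    have h := M.finrank_sigmaInv_snd_add_le
    obtain ⟨p, rfl⟩ : ∃ p, n = p + 2 := ⟨n - 2, by omega⟩
    have h₃ : finrank k M.V₂ ≤ finrank k M.sigmaInv.V₂ := by
      rw [show p + 2 - 1 = p + 1 from rfl] at h₂
      linarith
    refine ih _ (h₁.trans_le h₃) (h₃.trans ?_)
    exact Nat.le_mul_of_pos_left _ (by omega)

/-! ### Regularity in small dimensions -/

theorem Isomorphic.finrank_directSum {M A B : KroneckerRep.{u, v} k n}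
    (h : Isomorphic M (directSum A B)) :
    finrank k M.V₁ = finrank k A.V₁ + finrank k B.V₁ ∧
      finrank k M.V₂ = finrank k A.V₂ + finrank k B.V₂ := by
  obtain ⟨f, h₁, h₂⟩ := h
  exact ⟨(LinearEquiv.ofBijective f.f₁ h₁).finrank_eq.trans (finrank_prod (M := A.V₁)),
    (LinearEquiv.ofBijective f.f₂ h₂).finrank_eq.trans (finrank_prod (M := A.V₂))⟩

theorem Cofaithful.of_isDirectSummand {M A : KroneckerRep.{u, v} k n} (hM : M.Cofaithful)
    (hA : IsDirectSummand A M) : A.Cofaithful := by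
  obtain ⟨B, f, h₁, h₂⟩ := hA
  intro a ha
  obtain ⟨m, hm⟩ := h₁.2 (a, 0)
  have hm0 : m = 0 := hM m fun i => h₂.1 <| by
    rw [f.comm, hm, map_zero]
    exact Prod.ext (ha i) (map_zero (B.γ i))
  rw [hm0, map_zero] at hm
  exact (congrArg Prod.fst hm).symm

theorem SinkGenerated.of_isDirectSummand {M A : KroneckerRep.{u, v} k n} (hM : M.SinkGenerated)
    (hA : IsDirectSummand A M) : A.SinkGenerated := by
  obtain ⟨B, f, h₁, h₂⟩ := hA
  intro W hW
  have h := hM (W.comap (LinearMap.fst k A.V₂ B.V₂ ∘ₗ f.f₂)) fun i m => by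
    change (f.f₂ (M.γ i m)).1 ∈ W
    rw [f.comm]
    exact hW i _
  refine eq_top_iff.2 fun a _ => ?_
  obtain ⟨m, hm⟩ := h₂.2 (a, 0)
  have hmem : m ∈ W.comap (LinearMap.fst k A.V₂ B.V₂ ∘ₗ f.f₂) := h ▸ Submodule.mem_top
  change (f.f₂ m).1 ∈ W at hmem
  rwa [hm] at hmem

theorem SinkGenerated.subsingleton_snd {M : KroneckerRep.{u, v} k n} (hM : M.SinkGenerated)
    (h : Subsingleton M.V₁) : Subsingleton M.V₂ := by
  have := hM ⊥ fun i m => by rw [Subsingleton.elim m 0, map_zero]; exact Submodule.zero_mem _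
  exact (Submodule.subsingleton_iff k).1 (subsingleton_of_bot_eq_top this)

theorem Cofaithful.subsingleton_fst {M : KroneckerRep.{u, v} k n} (hM : M.Cofaithful)
    (h : Subsingleton M.V₂) : Subsingleton M.V₁ :=
  subsingleton_of_forall_eq 0 fun m => hM m fun _ => Subsingleton.elim _ _

/-- A representation with both dimensions less than `n` is regular as soon as it has no simple
direct summand. -/
theorem isRegular_of_finrank_lt {M : KroneckerRep.{u, v} k n} (h₁ : finrank k M.V₁ < n)
    (h₂ : finrank k M.V₂ < n) (hc : M.Cofaithful) (hs : M.SinkGenerated) : M.IsRegular := by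
  intro A hA
  have hcA := hc.of_isDirectSummand hA
  have hsA := hs.of_isDirectSummand hA
  obtain ⟨B, hB⟩ := hA
  obtain ⟨e₁, e₂⟩ := hB.finrank_directSum
  have key (hA : ¬ A.IsZero) : 0 < finrank k A.V₁ ∧ 0 < finrank k A.V₂ := by
    constructor <;> refine Nat.pos_of_ne_zero fun h => hA ?_ <;>
      have h := finrank_zero_iff.1 h
    · exact ⟨h, hsA.subsingleton_snd h⟩
    · exact ⟨hcA.subsingleton_fst h, h⟩
  constructor
  · rintro ⟨⟨hA, -⟩, t, ht⟩
    obtain ⟨p₁, p₂⟩ := key hA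
    refine not_isZero_sigma_iterate (by omega) t A p₁ ?_ ht
    exact le_trans (by omega) (Nat.le_mul_of_pos_right (n - 1) p₁)
  · rintro ⟨⟨hA, -⟩, t, ht⟩
    obtain ⟨p₁, p₂⟩ := key hA
    refine not_isZero_sigmaInv_iterate (by omega) t A p₂ ?_ ht
    exact le_trans (by omega) (Nat.le_mul_of_pos_right (n - 1) p₂)

theorem indecomposable_of_finrank_add_eq_one {M : KroneckerRep.{u, v} k n}
    (h : finrank k M.V₁ + finrank k M.V₂ = 1) : M.Indecomposable := by
  refine ⟨?_, fun A B hAB => ?_⟩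
  · rintro ⟨h₁, h₂⟩
    rw [finrank_zero_of_subsingleton, finrank_zero_of_subsingleton] at h
    omega
  · obtain ⟨e₁, e₂⟩ := hAB.finrank_directSum
    by_cases hA : finrank k A.V₁ = 0 ∧ finrank k A.V₂ = 0
    · exact .inl ⟨finrank_zero_iff.1 hA.1, finrank_zero_iff.1 hA.2⟩
    · exact .inr ⟨(finrank_zero_iff (R := k)).1 (by omega), (finrank_zero_iff (R := k)).1 (by omega)⟩

/-- If `M` is the internal direct sum of two subrepresentations, the first is a direct summand. -/
theorem Subrep.isDirectSummand_of_isCompl {M : KroneckerRep.{u, v} k n} (U W : M.Subrep)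
    (h₁ : IsCompl U.W₁ W.W₁) (h₂ : IsCompl U.W₂ W.W₂) : IsDirectSummand U.toRep M := by
  let e₁ := Submodule.prodEquivOfIsCompl _ _ h₁
  let e₂ := Submodule.prodEquivOfIsCompl _ _ h₂
  refine ⟨W.toRep, ⟨e₁.symm.toLinearMap, e₂.symm.toLinearMap, fun i m => ?_⟩, e₁.symm.bijective, e₂.symm.bijective⟩
  obtain ⟨⟨a, b⟩, rfl⟩ := e₁.surjective m
  change e₂.symm (M.γ i (e₁ (a, b))) = (directSum U.toRep W.toRep).γ i (e₁.symm (e₁ (a, b)))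
  rw [LinearEquiv.symm_apply_apply]
  exact e₂.symm_apply_eq.2 (map_add (M.γ i) (a : M.V₁) (b : M.V₁))

/-- A vector killed by all arrows spans a direct summand: any complement at the source, with all of
`M₂`, is a subrepresentation. This simple summand is preinjective. -/
theorem IsRegular.cofaithful {M : KroneckerRep.{u, v} k n} (hM : M.IsRegular) :
    M.Cofaithful := by
  intro m hm
  by_contra hne
  obtain ⟨C, hC⟩ := (k ∙ m).exists_isCompl
  let U : M.Subrep := ⟨k ∙ m, ⊥, fun i w hw => by
    obtain ⟨a, rfl⟩ := Submodule.mem_span_singleton.1 hw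
    rw [map_smul, hm, smul_zero]
    exact Submodule.zero_mem _⟩
  have hU : Subsingleton U.toRep.V₂ := inferInstanceAs (Subsingleton (⊥ : Submodule k M.V₂))
  refine (hM U.toRep (U.isDirectSummand_of_isCompl ⟨C, ⊤, fun _ _ _ => Submodule.mem_top⟩ hC
    isCompl_bot_top)).2 ⟨indecomposable_of_finrank_add_eq_one ?_, 1, hU, ?_⟩
  · rw [finrank_zero_of_subsingleton (M := U.toRep.V₂)]
    exact finrank_span_singleton hne
  · exact inferInstanceAs (Subsingleton (_ ⧸ LinearMap.range U.toRep.diagMap))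

theorem IsRegular.sinkGenerated {M : KroneckerRep.{u, v} k n} (hM : M.IsRegular) :
    M.SinkGenerated := by
  intro W hW
  by_contra hne
  -- A hyperplane containing all images makes its complementary line a summand of dimension `(0,
  -- 1)`, which `σ` kills.
  obtain ⟨H, hH, hWH⟩ := (eq_top_or_exists_le_coatom W).resolve_left hne
  obtain ⟨C, hC⟩ := H.exists_isCompl
  let U : M.Subrep := ⟨⊥, C, fun i w hw => by
    rw [(Submodule.mem_bot k).1 hw, map_zero]
    exact Submodule.zero_mem _⟩
  have hU : Subsingleton U.toRep.V₁ := inferInstanceAs (Subsingleton (⊥ : Submodule k M.V₁))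
  refine (hM U.toRep (U.isDirectSummand_of_isCompl ⟨⊤, H, fun i m _ => hWH (hW i m)⟩
    isCompl_bot_top hC.symm)).1 ⟨indecomposable_of_finrank_add_eq_one ?_, 1, ?_, hU⟩
  · rw [finrank_zero_of_subsingleton (M := U.toRep.V₁), zero_add]
    have hat : IsAtom C := hC.isCoatom_iff_isAtom.1 hH
    obtain ⟨c, hc, rfl⟩ := (atom_iff_nonzero_span C).1 hat
    exact finrank_span_singleton hc
  · exact inferInstanceAs (Subsingleton (LinearMap.ker U.toRep.sumMap))

/-! ### Subrepresentations, quotients and elementary representations -/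

/-- The quotient of a representation by a subrepresentation. -/
def Subrep.quotient {M : KroneckerRep.{u, v} k n} (U : M.Subrep) : KroneckerRep.{u, v} k n where
  V₁ := M.V₁ ⧸ U.W₁
  V₂ := M.V₂ ⧸ U.W₂
  γ i := U.W₁.mapQ U.W₂ (M.γ i) (U.map_mem i)

/-- The inclusion of a subrepresentation. -/
def Subrep.incl {M : KroneckerRep.{u, v} k n} (U : M.Subrep) : Hom U.toRep M where
  f₁ := U.W₁.subtype
  f₂ := U.W₂.subtype
  comm _ _ := rfl

/-- The projection onto the quotient by a subrepresentation. -/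
def Subrep.proj {M : KroneckerRep.{u, v} k n} (U : M.Subrep) : Hom M U.quotient where
  f₁ := U.W₁.mkQ
  f₂ := U.W₂.mkQ
  comm _ _ := rfl

theorem Subrep.isShortExact {M : KroneckerRep.{u, v} k n} (U : M.Subrep) :
    IsShortExact U.incl U.proj :=
  ⟨⟨U.W₁.injective_subtype, U.W₂.injective_subtype⟩,
    ⟨LinearMap.exact_subtype_mkQ _, LinearMap.exact_subtype_mkQ _⟩,
    ⟨U.W₁.mkQ_surjective, U.W₂.mkQ_surjective⟩⟩

theorem SinkGenerated.quotient {M : KroneckerRep.{u, v} k n} (hM : M.SinkGenerated)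
    (U : M.Subrep) : U.quotient.SinkGenerated := by
  intro W hW
  have h := hM (W.comap U.W₂.mkQ) fun i m => hW i (U.W₁.mkQ m)
  refine eq_top_iff.2 fun w _ => ?_
  obtain ⟨m, rfl⟩ := U.W₂.mkQ_surjective w
  exact (h ▸ Submodule.mem_top : m ∈ W.comap U.W₂.mkQ)

theorem Cofaithful.toRep {M : KroneckerRep.{u, v} k n} (hM : M.Cofaithful)
    (U : M.Subrep) : U.toRep.Cofaithful := fun m hm =>
  Subtype.ext (hM m.1 fun i => congrArg Subtype.val (hm i))

/-- The largest subrepresentation with given space `W` at the sink. -/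
def largestOver (M : KroneckerRep.{u, v} k n) (W : Submodule k M.V₂) : M.Subrep where
  W₁ := ⨅ i, W.comap (M.γ i)
  W₂ := W
  map_mem i _ hm := (Submodule.mem_iInf _).1 hm i

/-- By maximality: a class killed by all arrows is represented by an element sent into `W` by every
arrow, hence already in the subrepresentation. -/
theorem cofaithful_quotient_largestOver (M : KroneckerRep.{u, v} k n) (W : Submodule k M.V₂) :
    (M.largestOver W).quotient.Cofaithful := by
  intro q hq
  obtain ⟨m, rfl⟩ := (M.largestOver W).W₁.mkQ_surjective q
  refine (Submodule.Quotient.mk_eq_zero _).2 ((Submodule.mem_iInf _).2 fun i => ?_)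
  exact (Submodule.Quotient.mk_eq_zero W).1 (hq i)

theorem sinkGenerated_largestOver_span (M : KroneckerRep.{u, v} k n) (m : M.V₁) :
    (M.largestOver (Submodule.span k (Set.range fun i => M.γ i m))).toRep.SinkGenerated := by
  intro W hW
  let S := Submodule.span k (Set.range fun i => M.γ i m)
  have hm : m ∈ (M.largestOver S).W₁ := (Submodule.mem_iInf _).2 fun i =>
    Submodule.subset_span ⟨i, rfl⟩
  have hle : S ≤ W.map S.subtype := Submodule.span_le.2 <| by
    rintro _ ⟨i, rfl⟩
    exact ⟨(M.largestOver S).toRep.γ i ⟨m, hm⟩, hW i ⟨m, hm⟩, rfl⟩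
  refine eq_top_iff.2 fun w _ => ?_
  obtain ⟨w', hw', e⟩ := hle w.2
  exact (Subtype.ext e : w' = w) ▸ hw'

theorem IsElementary.span_arrows_eq_top {M : KroneckerRep.{u, v} k n} (hM : M.IsElementary)
    (h₁ : finrank k M.V₁ < n) (h₂ : finrank k M.V₂ < n) {m : M.V₁} (hm : m ≠ 0) :
    Submodule.span k (Set.range fun i => M.γ i m) = ⊤ := by
  obtain ⟨-, hreg, hno⟩ := hM
  by_contra hne
  set S := Submodule.span k (Set.range fun i => M.γ i m)
  let U := M.largestOver S
  have hmU : m ∈ U.W₁ := (Submodule.mem_iInf _).2 fun i => Submodule.subset_span ⟨i, rfl⟩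
  refine hno ⟨U.toRep, U.quotient, U.incl, U.proj, U.isShortExact, ?_, ?_, ?_, ?_⟩
  · rintro ⟨h, -⟩
    exact hm (congrArg Subtype.val (h.elim (⟨m, hmU⟩ : U.W₁) (0 : U.W₁)))
  · exact isRegular_of_finrank_lt ((Submodule.finrank_le U.W₁).trans_lt h₁)
      ((Submodule.finrank_le U.W₂).trans_lt h₂) (hreg.cofaithful.toRep U)
      (M.sinkGenerated_largestOver_span m)
  · rintro ⟨-, h⟩
    exact hne (Submodule.Quotient.subsingleton_iff.1 h)
  · exact isRegular_of_finrank_lt ((Submodule.finrank_quotient_le U.W₁).trans_lt h₁)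
      ((Submodule.finrank_quotient_le U.W₂).trans_lt h₂) (M.cofaithful_quotient_largestOver S)
      (hreg.sinkGenerated.quotient U)

theorem isElementary_of_span_arrows_eq_top {M : KroneckerRep.{u, v} k n}
    (h₁ : finrank k M.V₁ < n) (h₂ : finrank k M.V₂ < n)
    (p₁ : 0 < finrank k M.V₁) (p₂ : 0 < finrank k M.V₂)
    (h : ∀ m : M.V₁, m ≠ 0 → Submodule.span k (Set.range fun i => M.γ i m) = ⊤) :
    M.IsElementary := by
  have : Nontrivial M.V₁ := finrank_pos_iff.1 p₁
  have : Nontrivial M.V₂ := finrank_pos_iff.1 p₂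
  refine ⟨fun hz => not_subsingleton _ hz.1, isRegular_of_finrank_lt h₁ h₂ ?_ ?_, ?_⟩
  · intro m hm
    by_contra hne
    refine bot_ne_top (α := Submodule k M.V₂) ((eq_bot_iff.2 ?_).symm.trans (h m hne))
    refine Submodule.span_le.2 ?_
    rintro _ ⟨i, rfl⟩
    exact hm i
  · intro W hW
    obtain ⟨m, hm⟩ := exists_ne (0 : M.V₁)
    refine eq_top_iff.2 (h m hm ▸ Submodule.span_le.2 ?_)
    rintro _ ⟨i, rfl⟩
    exact hW i m
  · rintro ⟨L, N, f, g, ⟨⟨i₁, -⟩, ⟨-, x₂⟩, ⟨-, s₂⟩⟩, hL, hLr, hN, hNr⟩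
    have hL₁ : ¬ Subsingleton L.V₁ := fun h => hL ⟨h, hLr.sinkGenerated.subsingleton_snd h⟩
    rw [not_subsingleton_iff_nontrivial] at hL₁
    obtain ⟨l, hl⟩ := exists_ne (0 : L.V₁)
    -- The image of `L` contains the nonzero `f.f₁ l`, hence everything it generates.
    have hrange : LinearMap.range f.f₂ = ⊤ := by
      refine eq_top_iff.2 (h (f.f₁ l) (fun h0 => hl (i₁ (h0.trans (map_zero f.f₁).symm))) ▸
        Submodule.span_le.2 ?_)
      rintro _ ⟨i, rfl⟩
      exact ⟨L.γ i l, f.comm i l⟩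
    have hN₂ : Subsingleton N.V₂ := subsingleton_of_forall_eq 0 fun w => by
      obtain ⟨v, rfl⟩ := s₂ w
      have hv : v ∈ LinearMap.range f.f₂ := hrange ▸ Submodule.mem_top
      exact (x₂ v).2 hv
    exact hN ⟨hNr.cofaithful.subsingleton_fst hN₂, hN₂⟩

theorem dimVec_generated_eq_iff (M : KroneckerRep.{u, v} k n) {m : M.V₁} (hm : m ≠ 0) :
    (M.generated m).toRep.dimVec = (1, finrank k M.V₂) ↔
      Submodule.span k (Set.range fun i => M.γ i m) = ⊤ := by
  change (finrank k (k ∙ m), finrank k (Submodule.span k (Set.range fun i => M.γ i m))) = _ ↔ _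
  rw [finrank_span_singleton (K := k) hm, Prod.mk_right_inj]
  exact ⟨Submodule.eq_top_of_finrank_eq, fun h => by rw [h, finrank_top]⟩

end KroneckerRep

theorem mainTheorem5 {k : Type u} [Field k] [IsAlgClosed k] {n : ℕ}
    (M : KroneckerRep.{u, v} k n) (hM : ¬ M.IsZero) (x y : ℕ) (hdim : M.dimVec = (x, y))
    (hF : (x, y) ∈ KroneckerRep.F n) (hx : (x : ℤ) ≤ (n : ℤ) - 1) :
    M.IsElementary ↔ ∀ m : M.V₁, m ≠ 0 → (M.generated m).toRep.dimVec = (1, y) := by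
  obtain ⟨rfl, rfl⟩ := Prod.mk.inj hdim
  obtain ⟨hF₁, hF₂⟩ := hF
  dsimp only at hF₁ hF₂
  have h₁ : Module.finrank k M.V₁ < n := by omega
  have hle : Module.finrank k M.V₂ ≤ Module.finrank k M.V₁ := by exact_mod_cast hF₂
  have p₁ : 0 < Module.finrank k M.V₁ := by
    refine Nat.pos_of_ne_zero fun h => hM ⟨?_, ?_⟩ <;>
      apply (Module.finrank_zero_iff (R := k)).1 <;> omega
  -- The lower bound `(2 / n) x ≤ y` serves only to exclude `y = 0`.
  have p₂ : 0 < Module.finrank k M.V₂ := by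
    have hn : (0 : ℚ) < n := by exact_mod_cast p₁.trans h₁
    have hp : (0 : ℚ) < Module.finrank k M.V₁ := by exact_mod_cast p₁
    have : (0 : ℚ) < Module.finrank k M.V₂ := lt_of_lt_of_le (by positivity) hF₁
    exact_mod_cast this
  constructor
  · intro h m hm
    exact (M.dimVec_generated_eq_iff hm).2 (h.span_arrows_eq_top h₁ (by omega) hm)
  · intro h
    exact KroneckerRep.isElementary_of_span_arrows_eq_top h₁ (by omega) p₁ p₂ fun m hm =>
      (M.dimVec_generated_eq_iff hm).1 (h m hm)
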